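/- **Setting.** Let $N,L,L_C,L_F,\lambda,\Lambda$ be natural numbers with $\lambda,\Lambda\ge 1$, $\lfloor\Lambda/\lambda\rfloor\le N$, $L_F\le L$ and $L_C+L_F\le T:=L-L_F+1$. Let $\theta\in\mathbb{R}^D$, $\eta\neq 0$, $\sigma>0$, $C>0$, let $f_\theta$ be an arbitrary parametric model on context windows in $\mathbb{R}^{L_C}$ and $\mathcal{L}$ an arbitrary real-valued loss comparing a model output with a forecast window in $\mathbb{R}^{L_F}$. A dataset is a family $x=(x_1,\dots,x_N)$ of series $x_n\in\mathbb{R}^L$. Write $x\simeq x'$ if $x$ and $x'$ differ in at most one series, and there in at most one time index. For distributions $P\ll Q$ and $\alpha\ge 0$ let $H_\alpha(P\|Q)=\int\max\{\frac{dP}{dQ}-\alpha,0\}\,dQ$. Let $\mathit{MoG}(\mu,p,\sigma)=\sum_k p_k\,\mathcal{N}(\mu_k,\sigma^2)$. **Mechanism.** A training step $\tilde M$ maps $x$ to the random vector in $\mathbb{R}^D$ obtained as follows. 1. (Top level, without replacement.) Draw a uniformly random permutation $\pi$ of $\{1,\dots,N\}$ and select $x_{\pi(1)},\dots,x_{\pi(N')}$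 with $N'=\lfloor\Lambda/\lambda\rfloor$. 2. (Bottom level.) Independently for each selected series, prepend $L_C$ zeros and choose starting indices in $\{1,\dots,T\}$: either $\lambda$ independent uniform indices (*sampling with replacement*), or each index independently with probability $\min\{1,\lambda/T\}$ (*Poisson sampling*). Each chosen index $t$ contributes to the batch (a multiset) the length-$(L_C+L_F)$ subsequence of the padded series that starts at $t$. 3. (Noisy step.) For each batch element $a$, with first $L_C$ entries $a_C$ and last $L_F$ entries $a_F$, let $g_a=\nabla_\theta\mathcal{L}(f_\theta(a_C),a_F)$ (read as $0$ if the gradient does not exist) and clip it to $g_a/\max\{1,\|g_a\|_2/C\}$. With $\hat g$ the sum of the clipped gradients and $Z\sim\mathcal{N}(0,\sigma^2C^2 I)$, output $\theta-\eta\cdot\frac1\Lambda(\hat g+Z)$. Let $\tilde M_x$ be the law of the output, let $\tilde H(\alpha)=\sup_{x\simeq x'}H_\alpha(\tilde M_x\|\tilde M_{x'})$ be the per-step privacy profile, and let $\rho=\lfloor\Lambda/\lambda\rfloor/N$ (with $\rho=0$ if $N=0$). **Theorem.** For every $\alpha\ge 0$, $$\tilde H(\alpha)\le(1-\rho)\cdot\max\{0,1-\alpha\}+\rho\cdot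 H_\alpha(P\|Q),\qquad P=\mathit{MoG}(-\mu,p,\sigma),\quad Q=\mathit{MoG}(\mu,p,\sigma),$$ where * for bottom-level sampling with replacement, $\mu=(0,2,4,\dots,2\lambda)$ and $p_i=\binom{\lambda}{i-1}r^{i-1}(1-r)^{\lambda-i+1}$ for $1\le i\le\lambda+1$, with $r=\frac{L_C+L_F}{L-L_F+1}$; * for bottom-level Poisson sampling, $\mu=(0,1,\dots,L_C+L_F)$ and $p_i=\binom{L_C+L_F}{i-1}r^{i-1}(1-r)^{L_C+L_F-i+1}$ for $1\le i\le L_C+L_F+1$, with $r=\min\{1,\lambda/(L-L_F+1)\}$. -/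

import Mathlib

open MeasureTheory ProbabilityTheory
open scoped ENNReal NNReal

namespace BilevelForecasting

/-! ### Privacy notions -/

/-- Hockey stick divergence `H_α(P ‖ Q) = ∫ max {dP/dQ - α, 0} dQ` (for `P` absolutely continuous
with respect to `Q`), with values in `[0, ∞]`. The subtraction of `ℝ≥0∞` is truncated at `0`. -/
noncomputable def hockeyStick {E : Type*} [MeasurableSpace E] (α : ℝ) (P Q : Measure E) : ℝ≥0∞ :=
  ∫⁻ o, (P.rnDeriv Q o - ENNReal.ofReal α) ∂Q

/-- The univariate mixture of Gaussians with means `μ`, weights `p` and common standard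
deviation `σ`. -/
noncomputable def MoG {K : ℕ} (μ p : Fin K → ℝ) (σ : ℝ) : Measure ℝ :=
  ∑ k, ENNReal.ofReal (p k) • gaussianReal (μ k) ⟨σ ^ 2, sq_nonneg σ⟩

/-- The probability of the outcome `i` under the binomial distribution with `n` trials and success
probability `r`. -/
def binomialWeight (n : ℕ) (r : ℝ) (i : ℕ) : ℝ := n.choose i * r ^ i * (1 - r) ^ (n - i)

/-- A time series of length `L`. -/
abbrev Series (L : ℕ) := Fin L → ℝ

/-- A dataset `x = {x_1, …, x_N}` of `N` time series of length `L`. -/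
abbrev Dataset (N L : ℕ) := Fin N → Series L

/-- `w`-event-level neighbouring datasets: they differ in at most one pair of sequences
`x_n, x'_n`, and these differ only inside one range of indices of length `w`. -/
def EventNeighbors {N L : ℕ} (w : ℕ) (x x' : Dataset N L) : Prop :=
  ∃ n : Fin N, (∀ m, m ≠ n → x m = x' m) ∧
    ∃ t : Fin L, ∀ i : Fin L, ¬ ((t : ℕ) ≤ i ∧ (i : ℕ) < t + w) → x n i = x' n i

/-- The privacy profile `α ↦ sup_{x ≃ x'} H_α(M_x ‖ M_{x'})` under `1`-event-level privacy of a
mechanism, given as the map from datasets to output distributions. -/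
noncomputable def privacyProfile {N L : ℕ} {E : Type*} [MeasurableSpace E]
    (M : Dataset N L → Measure E) (α : ℝ) : ℝ≥0∞ :=
  ⨆ (x : Dataset N L) (x' : Dataset N L) (_ : EventNeighbors 1 x x'), hockeyStick α (M x) (M x')

/-! ### Bottom-level sampling -/

/-- The sequence `x` with `LC` zeros prepended (and continued by `0`; this continuation is never
read). Indices start at `0`. -/
def prependZeros {L : ℕ} (LC : ℕ) (x : Series L) (i : ℕ) : ℝ :=
  if h : LC ≤ i ∧ i - LC < L then x ⟨i - LC, h.2⟩ else 0

/-- The subsequence of length `LC + LF` of the padded sequence that starts at `t`; the admissible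
starting points are the `L - LF + 1` elements of `Fin (L - LF + 1)`. -/
def crop {L : ℕ} (LC LF : ℕ) (x : Series L) (t : Fin (L - LF + 1)) : Fin (LC + LF) → ℝ :=
  fun j => prependZeros LC x (t + j)

/-- Bottom-level sampling with replacement: `lam` independent uniform starting points. -/
noncomputable def sampleWithReplacement {L : ℕ} (LC LF lam : ℕ) (x : Series L) :
    PMF (Multiset (Fin (LC + LF) → ℝ)) :=
  (PMF.uniformOfFintype (Fin lam → Fin (L - LF + 1))).map fun t =>
    Finset.univ.val.map fun j => crop LC LF x (t j)

/-- The random subset of `Fin T` that contains each element independently with probability `r`. -/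
noncomputable def poissonSubset (T : ℕ) (r : ℝ≥0) (hr : r ≤ 1) : PMF (Finset (Fin T)) :=
  PMF.ofFintype (fun s => (r : ℝ≥0∞) ^ s.card * (1 - (r : ℝ≥0∞)) ^ (T - s.card)) (by
    rw [Fin.sum_pow_mul_eq_add_pow, add_tsub_cancel_of_le (by exact_mod_cast hr), one_pow])

/-- Bottom-level Poisson sampling: each of the `L - LF + 1` starting points is included
independently with probability `min {1, lam / (L - LF + 1)}`. -/
noncomputable def samplePoisson {L : ℕ} (LC LF lam : ℕ) (x : Series L) :
    PMF (Multiset (Fin (LC + LF) → ℝ)) :=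
  (poissonSubset (L - LF + 1) (min 1 ((lam : ℝ≥0) / ((L - LF + 1 : ℕ) : ℝ≥0)))
    (min_le_left _ _)).map fun s => s.val.map (crop LC LF x)

/-! ### The training step -/

/-- Independent draws from the given distributions, aggregated into a single multiset. -/
noncomputable def aggregate {A : Type*} : List (PMF (Multiset A)) → PMF (Multiset A)
  | [] => PMF.pure 0
  | p :: ps => p.bind fun s => (aggregate ps).map fun y => s + y

/-- The bi-level sample: top-level sampling without replacement of `N'` of the `N` sequences,
through a uniformly random permutation `π`, followed by independent bottom-level sampling from
each of `x_{π(1)}, …, x_{π(N')}`. -/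
noncomputable def sampleBatch {N N' L : ℕ} {A : Type*} (h : N' ≤ N)
    (bottom : Series L → PMF (Multiset A)) (x : Dataset N L) : PMF (Multiset A) :=
  (PMF.uniformOfFintype (Equiv.Perm (Fin N))).bind fun π =>
    aggregate ((List.finRange N').map fun n => bottom (x (π (Fin.castLE h n))))

/-- The gradient `∇_θ ℒ(f_θ(a_C), a_F)` for a subsequence `a`, where the context window `a_C`
consists of the first `LC` and the forecast window `a_F` of the last `LF` elements of `a`. -/
noncomputable def subsequenceGradient {D LC LF : ℕ} {O : Type*}
    (f : EuclideanSpace ℝ (Fin D) → (Fin LC → ℝ) → O) (loss : O → (Fin LF → ℝ) → ℝ)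
    (θ : EuclideanSpace ℝ (Fin D)) (a : Fin (LC + LF) → ℝ) : EuclideanSpace ℝ (Fin D) :=
  gradient (fun ϑ => loss (f ϑ fun i => a (Fin.castAdd LF i)) fun i => a (Fin.natAdd LC i)) θ

/-- Gradient clipping to norm `C`. -/
noncomputable def clip {D : ℕ} (C : ℝ) (g : EuclideanSpace ℝ (Fin D)) :
    EuclideanSpace ℝ (Fin D) :=
  (max 1 (‖g‖ / C))⁻¹ • g

/-- The output distribution of the noisy training step on the batch `y`, i.e. the law of
`θ - η g̃` with `g̃ = (ĝ + Z) / Lam`, where `ĝ` is the sum of the clipped gradients and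
`Z ~ N(0, σ² C² I)`. -/
noncomputable def noisyTrainingStep {D LC LF : ℕ} {O : Type*}
    (f : EuclideanSpace ℝ (Fin D) → (Fin LC → ℝ) → O) (loss : O → (Fin LF → ℝ) → ℝ)
    (θ : EuclideanSpace ℝ (Fin D)) (η σ C : ℝ) (Lam : ℕ) (y : Multiset (Fin (LC + LF) → ℝ)) :
    Measure (EuclideanSpace ℝ (Fin D)) :=
  (stdGaussian (EuclideanSpace ℝ (Fin D))).map fun z =>
    θ - η • ((1 / (Lam : ℝ)) •
      ((y.map fun a => clip C (subsequenceGradient f loss θ a)).sum + (σ * C) • z))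

/-- The law of a random element of `κ b`, where `b` is drawn from `p`. -/
noncomputable def mixture {B E : Type*} [MeasurableSpace E] (p : PMF B) (κ : B → Measure E) :
    Measure E :=
  Measure.sum fun b => p b • κ b

/-- The output distribution of a single training step with top-level sampling without replacement
of `⌊Lam / lam⌋` sequences and with the given bottom-level sampling. -/
noncomputable def trainingStep {N L D LC LF : ℕ} {O : Type*} {lam Lam : ℕ} (h : Lam / lam ≤ N)
    (bottom : Series L → PMF (Multiset (Fin (LC + LF) → ℝ)))
    (f : EuclideanSpace ℝ (Fin D) → (Fin LC → ℝ) → O) (loss : O → (Fin LF → ℝ) → ℝ)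
    (θ : EuclideanSpace ℝ (Fin D)) (η σ C : ℝ) (x : Dataset N L) :
    Measure (EuclideanSpace ℝ (Fin D)) :=
  mixture (sampleBatch h bottom x) (noisyTrainingStep f loss θ η σ C Lam)

/-! ### The bottom-level dominating pairs -/

/-- Mean vector `0, 2, …, 2 lam` and binomial weights for sampling with replacement; the sign
`s = -1` gives the first distribution of the pair and `s = 1` the second. -/
noncomputable def pairWithReplacement (s : ℝ) (L LC LF lam : ℕ) (σ : ℝ) : Measure ℝ :=
  MoG (K := lam + 1) (fun i => s * (2 * (i : ℝ)))
    (fun i => binomialWeight lam (((LC + LF : ℕ) : ℝ) / ((L - LF + 1 : ℕ) : ℝ)) i) σ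

/-- Mean vector `0, 1, …, LC + LF` and binomial weights for Poisson sampling; the sign
`s = -1` gives the first distribution of the pair and `s = 1` the second. -/
noncomputable def pairPoisson (s : ℝ) (L LC LF lam : ℕ) (σ : ℝ) : Measure ℝ :=
  MoG (K := LC + LF + 1) (fun i => s * (i : ℝ))
    (fun i => binomialWeight (LC + LF) (min 1 ((lam : ℝ) / ((L - LF + 1 : ℕ) : ℝ))) i) σ

end BilevelForecasting

/-! The divergence is bounded through tests: `H_α(P‖Q) ≤ K` follows once `P A ≤ K + α * Q A` for
every event `A`, and conversely `P A ≤ H_α(P‖Q) + α * Q A` when `P ≪ Q`. Fix an event and let `m u`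
be its probability when the sum of clipped gradients equals `u`. Everything then reduces to
comparing averages of `m` over the two batch distributions.

The analytic core is that `m` is dominated by a one-dimensional Gaussian test
(`exists_shift_dominating`, `IsGaussianTest`). Given a base point `b` with `m b = Φ(c)`,
Neyman-Pearson shows that moving by at most `C * t` keeps `m` between `Φ(c - t/σ)` and `Φ(c + t/σ)`,
the masses of one half line `S` under `N(t, σ²)` and `N(-t, σ²)`. Since `S` depends only on `b`,
bounds for different `t` can be averaged. If both gradient sums stay within `C * μ_k` of `b` with
probability `p_k`, then `E m(u) ≤ P S ≤ H_α(P‖Q) + α * Q S ≤ H_α(P‖Q) + α * E m(u')`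
(`IsGaussianTest.sum_le`). No worst-case pair of batches has to be identified.

It remains to find base points common to both datasets. At most `LC + LF` starting points see the
modified entry. Under Poisson sampling, the base is the sum over the chosen unaffected windows; each
affected window adds norm at most `C`, hence the means `k`. With replacement, each affected draw
takes the place of an unaffected one, which costs `2 * C`, hence the means `2 * k`.

The other selected series only translate `m`, which preserves the test property. The modified series
is selected with probability `ρ`; otherwise the two output laws agree, and `max 0 (1 - α)` is the
divergence of a law from itself. -/

namespace BilevelForecasting

/-! ### The Neyman-Pearson lemma for Gaussian shifts -/

/-- Neyman-Pearson: among the sets of at most the measure of `H`, a superlevel set `H` of the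
density `f` maximizes the integral of `f`. -/
theorem setLIntegral_le_of_superlevel {E : Type*} [MeasurableSpace E] {μ : Measure E}
    [IsFiniteMeasure μ] {f : E → ℝ≥0∞} {k : ℝ≥0∞} {B H : Set E}
    (hB : MeasurableSet B) (hH : MeasurableSet H) (h₁ : ∀ z ∈ H, k ≤ f z)
    (h₂ : ∀ z ∉ H, f z ≤ k) (hBH : μ B ≤ μ H) :
    ∫⁻ z in B, f z ∂μ ≤ ∫⁻ z in H, f z ∂μ := by
  have hd : μ (B \ H) ≤ μ (H \ B) := by
    rw [← measure_inter_add_sdiff B hH, ← measure_inter_add_sdiff H hB, Set.inter_comm H B] at hBH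
    exact (ENNReal.add_le_add_iff_left (measure_ne_top _ _)).1 hBH
  rw [← lintegral_inter_add_sdiff f B hH, ← lintegral_inter_add_sdiff f H hB, Set.inter_comm H B]
  gcongr 1
  calc ∫⁻ z in B \ H, f z ∂μ ≤ ∫⁻ _ in B \ H, k ∂μ :=
        setLIntegral_mono' (hB.diff hH) fun z hz => h₂ z hz.2
    _ = k * μ (B \ H) := by simp
    _ ≤ k * μ (H \ B) := by gcongr
    _ = ∫⁻ _ in H \ B, k ∂μ := by simp
    _ ≤ ∫⁻ z in H \ B, f z ∂μ := setLIntegral_mono' (hH.diff hB) fun z hz => h₁ z hz.1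

section shift

variable {D : ℕ}

/-- The Laplace transform at the complex point `v + i t` is the characteristic function of the
exponentially tilted Gaussian, up to normalization; it factors over the coordinates. -/
theorem integral_cexp_stdGaussian (v t : EuclideanSpace ℝ (Fin D)) :
    ∫ z, Complex.exp ((inner ℝ z v : ℝ) + (inner ℝ z t : ℝ) * Complex.I)
        ∂(stdGaussian (EuclideanSpace ℝ (Fin D))) =
      Complex.exp (‖v‖ ^ 2 / 2 + (inner ℝ v t : ℝ) * Complex.I - ‖t‖ ^ 2 / 2) := by
  have hprod (x : Fin D → ℝ) : Complex.exp ((inner ℝ (WithLp.toLp 2 x) v : ℝ) +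
      (inner ℝ (WithLp.toLp 2 x) t : ℝ) * Complex.I) =
      ∏ i, Complex.exp (((v i : ℂ) + t i * Complex.I) * x i) := by
    rw [← Complex.exp_sum]
    congr 1
    simp only [PiLp.inner_apply, RCLike.inner_apply, conj_trivial, Complex.ofReal_sum,
      Complex.ofReal_mul, Finset.sum_mul, ← Finset.sum_add_distrib]
    exact Finset.sum_congr rfl fun i _ => by ring
  have hone (c : ℂ) : ∫ x : ℝ, Complex.exp (c * x) ∂(gaussianReal 0 1) =
      Complex.exp (c ^ 2 / 2) := by
    simpa [complexMGF] using complexMGF_id_gaussianReal (μ := 0) (v := 1) c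
  rw [← map_pi_eq_stdGaussian, integral_map (by fun_prop)
    (Measurable.aestronglyMeasurable (by fun_prop))]
  simp_rw [hprod]
  rw [integral_fintype_prod_eq_prod (f := fun i (x : ℝ) =>
    Complex.exp (((v i : ℂ) + t i * Complex.I) * x))]
  simp_rw [hone]
  rw [← Complex.exp_sum, ← Complex.ofReal_pow, ← Complex.ofReal_pow,
    EuclideanSpace.real_norm_sq_eq, EuclideanSpace.real_norm_sq_eq]
  congr 1
  simp only [PiLp.inner_apply, RCLike.inner_apply, conj_trivial, Complex.ofReal_sum,
    Complex.ofReal_mul, Complex.ofReal_pow, Finset.sum_mul, Finset.sum_div, ← Finset.sum_add_distrib,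
    ← Finset.sum_sub_distrib]
  refine Finset.sum_congr rfl fun i _ => ?_
  linear_combination (t i : ℂ) ^ 2 / 2 * Complex.I_sq

/-- The Cameron-Martin density of a translate of the standard Gaussian. -/
theorem stdGaussian_map_add_right (v : EuclideanSpace ℝ (Fin D)) :
    (stdGaussian (EuclideanSpace ℝ (Fin D))).map (fun z => z + v) =
      (stdGaussian (EuclideanSpace ℝ (Fin D))).withDensity
        fun z => ENNReal.ofReal (Real.exp (inner ℝ z v - ‖v‖ ^ 2 / 2)) := by
  have hint : Integrable (fun z : EuclideanSpace ℝ (Fin D) =>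
      Real.exp (inner ℝ z v - ‖v‖ ^ 2 / 2)) (stdGaussian (EuclideanSpace ℝ (Fin D))) := by
    -- A nonzero Bochner integral forces integrability, so the closed formula at `t = 0` suffices.
    have h : ∫ z, Complex.exp ((inner ℝ z v : ℝ) + (inner ℝ z (0 : EuclideanSpace ℝ (Fin D)) : ℝ) *
        Complex.I) ∂(stdGaussian (EuclideanSpace ℝ (Fin D))) ≠ 0 := by
      rw [integral_cexp_stdGaussian]
      exact Complex.exp_ne_zero _
    have h' := (Integrable.of_integral_ne_zero h).norm
    simp only [inner_zero_right, Complex.ofReal_zero, zero_mul, add_zero, Complex.norm_exp,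
      Complex.ofReal_re] at h'
    simp_rw [Real.exp_sub]
    exact h'.div_const _
  have := isFiniteMeasure_withDensity_ofReal hint.2
  have := Measure.isProbabilityMeasure_map (μ := stdGaussian (EuclideanSpace ℝ (Fin D)))
    (f := fun z => z + v) (by fun_prop)
  refine Measure.ext_of_charFun ?_
  ext t
  rw [charFun_map_add_const, charFun_stdGaussian, charFun_apply,
    integral_withDensity_eq_integral_toReal_smul (by fun_prop) (by simp)]
  simp_rw [ENNReal.toReal_ofReal (Real.exp_pos _).le]
  have h (z : EuclideanSpace ℝ (Fin D)) :
      Real.exp (inner ℝ z v - ‖v‖ ^ 2 / 2) • Complex.exp ((inner ℝ z t : ℝ) * Complex.I) =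
      Complex.exp ((inner ℝ z v : ℝ) + (inner ℝ z t : ℝ) * Complex.I) *
        Complex.exp (-(‖v‖ ^ 2 / 2 : ℂ)) := by
    rw [Complex.real_smul, Complex.ofReal_exp, ← Complex.exp_add, ← Complex.exp_add]
    congr 1
    push_cast
    ring
  simp_rw [h]
  rw [integral_mul_const, integral_cexp_stdGaussian, ← Complex.exp_add, ← Complex.exp_add]
  congr 1
  ring

theorem stdGaussian_map_inner (e : EuclideanSpace ℝ (Fin D)) (he : ‖e‖ = 1) :
    (stdGaussian (EuclideanSpace ℝ (Fin D))).map (fun z => inner ℝ e z) = gaussianReal 0 1 := by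
  have h := IsGaussian.map_eq_gaussianReal (μ := stdGaussian (EuclideanSpace ℝ (Fin D)))
    (innerSL ℝ e)
  rw [integral_strongDual_stdGaussian, variance_dual_stdGaussian, innerSL_apply_norm, he] at h
  simpa using h

theorem gaussianReal_Iic_neg (a c : ℝ) :
    gaussianReal (-a) 1 (Set.Iic c) = gaussianReal 0 1 (Set.Iic (c + a)) := by
  have h := gaussianReal_map_sub_const (μ := 0) (v := 1) a
  rw [zero_sub] at h
  rw [← h, Measure.map_apply (by fun_prop) measurableSet_Iic]
  congr 1
  ext x
  simp

/-- A Gaussian shift increases the mass of a set at most as much as that of a half line. -/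
theorem stdGaussian_shift_le {B : Set (EuclideanSpace ℝ (Fin D))} (hB : MeasurableSet B) {c : ℝ}
    (hc : stdGaussian (EuclideanSpace ℝ (Fin D)) B ≤ gaussianReal 0 1 (Set.Iic c))
    {v : EuclideanSpace ℝ (Fin D)} {a : ℝ} (ha : ‖v‖ ≤ a) :
    stdGaussian (EuclideanSpace ℝ (Fin D)) {z | z + v ∈ B} ≤
      gaussianReal 0 1 (Set.Iic (c + a)) := by
  refine le_trans ?_ (measure_mono (Set.Iic_subset_Iic.2 (add_le_add_right ha c)))
  rcases eq_or_ne v 0 with rfl | hv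
  · simpa using hc
  have hv' : 0 < ‖v‖ := norm_pos_iff.2 hv
  -- With `e` opposite to `v`, the density of the shift decreases in `⟪e, z⟫`. Hence the half space
  -- `H` is a superlevel set, and its shift has mass `Φ(c + ‖v‖)`.
  set e := -(‖v‖⁻¹ • v) with he
  have hen : ‖e‖ = 1 := by
    rw [he, norm_neg, norm_smul, norm_inv, norm_norm, inv_mul_cancel₀ hv'.ne']
  have hve : v = -(‖v‖ • e) := by
    rw [he, smul_neg, smul_smul, mul_inv_cancel₀ hv'.ne', one_smul, neg_neg]
  set H := {z : EuclideanSpace ℝ (Fin D) | inner ℝ e z ≤ c} with hHdef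
  have hH : MeasurableSet H := measurableSet_le (by fun_prop) (by fun_prop)
  have hlaw (s : ℝ) : stdGaussian (EuclideanSpace ℝ (Fin D)) {z | inner ℝ e z ≤ s} =
      gaussianReal 0 1 (Set.Iic s) := by
    rw [← stdGaussian_map_inner e hen, Measure.map_apply (by fun_prop) measurableSet_Iic]
    rfl
  have hHshift : {z : EuclideanSpace ℝ (Fin D) | z + v ∈ H} = {z | inner ℝ e z ≤ c + ‖v‖} := by
    ext z
    have : (inner ℝ e v : ℝ) = -‖v‖ := by
      conv_lhs => rw [hve, inner_neg_right, inner_smul_right, real_inner_self_eq_norm_sq, hen]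
      ring
    simp only [hHdef, Set.mem_ofPred_eq, inner_add_right, this]
    constructor <;> intro h <;> linarith
  have hmap {S : Set (EuclideanSpace ℝ (Fin D))} (hS : MeasurableSet S) :
      stdGaussian (EuclideanSpace ℝ (Fin D)) {z | z + v ∈ S} =
      ∫⁻ z in S, ENNReal.ofReal (Real.exp (inner ℝ z v - ‖v‖ ^ 2 / 2))
        ∂(stdGaussian (EuclideanSpace ℝ (Fin D))) := by
    rw [← withDensity_apply _ hS, ← stdGaussian_map_add_right, Measure.map_apply (by fun_prop) hS]
    rfl
  have hin (z : EuclideanSpace ℝ (Fin D)) : (inner ℝ z v : ℝ) = -(‖v‖ * inner ℝ e z) := by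
    conv_lhs => rw [hve, inner_neg_right, inner_smul_right, real_inner_comm]
  rw [← hlaw, ← hHshift, hmap hB, hmap hH]
  refine setLIntegral_le_of_superlevel (k := ENNReal.ofReal (Real.exp (-(‖v‖ * c) - ‖v‖ ^ 2 / 2)))
    hB hH (fun z hz => ?_) (fun z hz => ?_) (by rwa [hlaw])
  · have : (inner ℝ e z : ℝ) ≤ c := hz
    rw [hin]
    gcongr
  · have : c ≤ inner ℝ e z := (not_le.1 hz).le
    rw [hin]
    gcongr

/-- The Gaussian has no atoms, so its distribution function is continuous and the intermediate value
theorem applies. -/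
theorem exists_gaussianReal_Iic_eq {p : ℝ≥0∞} (h0 : p ≠ 0) (h1 : p < 1) :
    ∃ c, gaussianReal 0 1 (Set.Iic c) = p := by
  have hcont : Continuous (cdf (gaussianReal 0 1)) := by
    rw [continuous_iff_continuousAt]
    intro x
    have hx := (cdf (gaussianReal 0 1)).measure_singleton x
    have : NullSingletonClass (gaussianReal 0 1) := nullSingletonClass_gaussianReal one_ne_zero
    rw [measure_cdf] at hx
    rw [measure_singleton, eq_comm, ENNReal.ofReal_eq_zero, sub_nonpos] at hx
    rw [(monotone_cdf _).continuousAt_iff_leftLim_eq_rightLim,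
      StieltjesFunction.rightLim_eq]
    exact le_antisymm ((monotone_cdf _).leftLim_le le_rfl) hx
  have hp0 : 0 < p.toReal := ENNReal.toReal_pos h0 (h1.trans ENNReal.one_lt_top).ne
  have hp1 : p.toReal < 1 := by
    simpa using (ENNReal.toReal_lt_toReal (h1.trans ENNReal.one_lt_top).ne ENNReal.one_ne_top).2 h1
  obtain ⟨c, hc⟩ := mem_range_of_exists_le_of_exists_ge hcont
    ((tendsto_cdf_atBot (gaussianReal 0 1)).eventually_le_const hp0).exists
    ((tendsto_cdf_atTop (gaussianReal 0 1)).eventually_const_le hp1).exists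
  refine ⟨c, ?_⟩
  rw [← ofReal_cdf, hc, ENNReal.ofReal_toReal (h1.trans ENNReal.one_lt_top).ne]

theorem gaussianReal_Iic_compl (c : ℝ) :
    gaussianReal 0 1 (Set.Iic c)ᶜ = gaussianReal 0 1 (Set.Iic (-c)) := by
  have : NullSingletonClass (gaussianReal 0 1) := nullSingletonClass_gaussianReal one_ne_zero
  have h := gaussianReal_map_neg (μ := 0) (v := 1)
  rw [neg_zero] at h
  rw [Set.compl_Iic, measure_congr (Ioi_ae_eq_Ici (μ := gaussianReal 0 1))]
  conv_rhs => rw [← h, Measure.map_apply (by fun_prop) measurableSet_Iic]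
  congr 1
  ext x
  simp

/-- This is `stdGaussian_shift_le` for the complement, by the symmetry `1 - Φ(c) = Φ(-c)`. -/
theorem stdGaussian_le_shift {B : Set (EuclideanSpace ℝ (Fin D))} (hB : MeasurableSet B) {c : ℝ}
    (hc : gaussianReal 0 1 (Set.Iic c) ≤ stdGaussian (EuclideanSpace ℝ (Fin D)) B)
    {v : EuclideanSpace ℝ (Fin D)} {a : ℝ} (ha : ‖v‖ ≤ a) :
    gaussianReal 0 1 (Set.Iic (c - a)) ≤
      stdGaussian (EuclideanSpace ℝ (Fin D)) {z | z + v ∈ B} := by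
  have hBc : stdGaussian (EuclideanSpace ℝ (Fin D)) Bᶜ ≤ gaussianReal 0 1 (Set.Iic (-c)) := by
    rw [← gaussianReal_Iic_compl, prob_compl_eq_one_sub hB, prob_compl_eq_one_sub measurableSet_Iic]
    gcongr
  have h := stdGaussian_shift_le hB.compl hBc ha
  have hBv : MeasurableSet {z : EuclideanSpace ℝ (Fin D) | z + v ∈ B} :=
    (measurable_id.add_const v) hB
  have hcomp : {z : EuclideanSpace ℝ (Fin D) | z + v ∈ Bᶜ} = {z | z + v ∈ B}ᶜ := rfl
  rw [hcomp, show -c + a = -(c - a) by ring, ← gaussianReal_Iic_compl,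
    prob_compl_eq_one_sub hBv, prob_compl_eq_one_sub measurableSet_Iic] at h
  exact (ENNReal.sub_le_sub_iff_left prob_le_one (by simp)).1 h

/-- The masses of the translates of a set in `ℝ^D` under a Gaussian are controlled by those of
the translates of a single subset of `ℝ`. -/
theorem exists_shift_dominating {B : Set (EuclideanSpace ℝ (Fin D))} (hB : MeasurableSet B) :
    ∃ S : Set ℝ, MeasurableSet S ∧ ∀ (v : EuclideanSpace ℝ (Fin D)) (a : ℝ), ‖v‖ ≤ a →
      stdGaussian (EuclideanSpace ℝ (Fin D)) {z | z + v ∈ B} ≤ gaussianReal (-a) 1 S ∧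
      gaussianReal a 1 S ≤ stdGaussian (EuclideanSpace ℝ (Fin D)) {z | z + v ∈ B} := by
  have hac (v : EuclideanSpace ℝ (Fin D)) {S : Set (EuclideanSpace ℝ (Fin D))}
      (hS : MeasurableSet S) (h : stdGaussian (EuclideanSpace ℝ (Fin D)) S = 0) :
      stdGaussian (EuclideanSpace ℝ (Fin D)) {z | z + v ∈ S} = 0 := by
    have h' : (stdGaussian (EuclideanSpace ℝ (Fin D))).map (fun z => z + v) S = 0 := by
      rw [stdGaussian_map_add_right]
      exact withDensity_absolutelyContinuous _ _ h
    rwa [Measure.map_apply (by fun_prop) hS] at h'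
  -- Masses `0` and `1` are no values of `Φ`. A translate of the Gaussian is absolutely continuous,
  -- so these masses persist under every shift, and `∅` and `univ` serve as `S`.
  by_cases h0 : stdGaussian (EuclideanSpace ℝ (Fin D)) B = 0
  · exact ⟨∅, MeasurableSet.empty, fun v a _ => by simp [hac v hB h0]⟩
  rcases (prob_le_one (μ := stdGaussian (EuclideanSpace ℝ (Fin D))) (s := B)).eq_or_lt with h1 | h1
  · refine ⟨Set.univ, MeasurableSet.univ, fun v a _ => ?_⟩
    have hBv : MeasurableSet {z : EuclideanSpace ℝ (Fin D) | z + v ∈ B} :=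
      (measurable_id.add_const v) hB
    have : stdGaussian (EuclideanSpace ℝ (Fin D)) {z | z + v ∈ B} = 1 := by
      rw [← prob_compl_eq_zero_iff hBv]
      exact hac v hB.compl ((prob_compl_eq_zero_iff hB).2 h1)
    simp [this]
  · obtain ⟨c, hc⟩ := exists_gaussianReal_Iic_eq h0 h1
    refine ⟨Set.Iic c, measurableSet_Iic, fun v a ha => ⟨?_, ?_⟩⟩
    · rw [gaussianReal_Iic_neg]
      exact stdGaussian_shift_le hB hc.ge ha
    · have h := gaussianReal_Iic_neg (-a) c
      rw [neg_neg, ← sub_eq_add_neg] at h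
      rw [h]
      exact stdGaussian_le_shift hB hc.le ha

/-- A function `m` of a mean vector behaves, around every base point, like the acceptance
probability of a one-dimensional Gaussian test. -/
def IsGaussianTest (C σ : ℝ) (m : EuclideanSpace ℝ (Fin D) → ℝ≥0∞) : Prop :=
  ∀ b, ∃ S : Set ℝ, MeasurableSet S ∧ ∀ (u : EuclideanSpace ℝ (Fin D)) (t : ℝ), ‖u - b‖ ≤ C * t →
    m u ≤ gaussianReal (-t) (σ ^ 2).toNNReal S ∧
      gaussianReal t (σ ^ 2).toNNReal S ≤ m u

theorem IsGaussianTest.comp_const_add {C σ : ℝ} {m : EuclideanSpace ℝ (Fin D) → ℝ≥0∞}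
    (hm : IsGaussianTest C σ m) (c : EuclideanSpace ℝ (Fin D)) :
    IsGaussianTest C σ fun u => m (c + u) := by
  intro b
  obtain ⟨S, hS, h⟩ := hm (c + b)
  exact ⟨S, hS, fun u t hu => h _ t (by simpa using hu)⟩

theorem isGaussianTest_stdGaussian {C σ : ℝ} (hC : 0 < C) (hσ : 0 < σ)
    {B : Set (EuclideanSpace ℝ (Fin D))} (hB : MeasurableSet B) :
    IsGaussianTest C σ fun u =>
      stdGaussian (EuclideanSpace ℝ (Fin D)) {z | u + (σ * C) • z ∈ B} := by
  intro b
  have hs : 0 < σ * C := mul_pos hσ hC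
  have hB' : MeasurableSet {z : EuclideanSpace ℝ (Fin D) | b + (σ * C) • z ∈ B} :=
    (measurable_const.add (measurable_id.const_smul (σ * C))) hB
  obtain ⟨S, hS, h⟩ := exists_shift_dominating hB'
  have hscale (t : ℝ) : gaussianReal t (σ ^ 2).toNNReal ((fun x => σ⁻¹ * x) ⁻¹' S) =
      gaussianReal (σ⁻¹ * t) 1 S := by
    rw [← Measure.map_apply (by fun_prop) hS, gaussianReal_map_const_mul]
    congr 2
    refine NNReal.eq ?_
    simp [Real.coe_toNNReal _ (sq_nonneg σ), hσ.ne']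
  -- The noise has scale `σ * C` and distances are measured in units of `C`, so the factor `C`
  -- cancels and only a rescaling of `S` by `σ` remains.
  refine ⟨(fun x => σ⁻¹ * x) ⁻¹' S, (measurable_const_mul σ⁻¹) hS, fun u t hu => ?_⟩
  rw [hscale, hscale, mul_neg]
  have hset : {z : EuclideanSpace ℝ (Fin D) | u + (σ * C) • z ∈ B} =
      {z | z + (σ * C)⁻¹ • (u - b) ∈
        {z : EuclideanSpace ℝ (Fin D) | b + (σ * C) • z ∈ B}} := by
    ext z
    simp only [Set.mem_ofPred_eq, smul_add, smul_smul, mul_inv_cancel₀ hs.ne', one_smul]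
    rw [show b + ((σ * C) • z + (u - b)) = u + (σ * C) • z by abel]
  beta_reduce
  rw [hset]
  refine h _ _ ?_
  rw [norm_smul, norm_inv, Real.norm_of_nonneg hs.le, mul_inv, mul_assoc]
  gcongr
  rwa [inv_mul_le_iff₀ hC]

end shift

/-! ### Hockey stick divergence and tests -/

/-- The optimal event is the set where the density is at least `α`. Only the absolutely continuous
part of `P` enters the divergence, so `P ≪ Q` is not needed in this direction. -/
theorem hockeyStick_le {E : Type*} [MeasurableSpace E] {α : ℝ} {P Q : Measure E}
    [IsFiniteMeasure Q] {K : ℝ≥0∞}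
    (h : ∀ A, MeasurableSet A → P A ≤ K + ENNReal.ofReal α * Q A) : hockeyStick α P Q ≤ K := by
  set A := {o | ENNReal.ofReal α ≤ P.rnDeriv Q o} with hA
  have hAm : MeasurableSet A := measurableSet_le measurable_const (P.measurable_rnDeriv Q)
  have hzero : ∀ o ∈ Aᶜ, P.rnDeriv Q o - ENNReal.ofReal α = 0 :=
    fun o (ho : ¬ _ ≤ _) => tsub_eq_zero_of_le (not_le.1 ho).le
  have hfin : ∫⁻ _ in A, ENNReal.ofReal α ∂Q ≠ ∞ := by
    simpa using ENNReal.mul_ne_top ENNReal.ofReal_ne_top (measure_ne_top Q A)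
  calc hockeyStick α P Q
      = ∫⁻ o in A, (P.rnDeriv Q o - ENNReal.ofReal α) ∂Q := by
        rw [hockeyStick, ← lintegral_add_compl _ hAm, setLIntegral_congr_fun hAm.compl hzero,
          lintegral_zero, add_zero]
    _ = ∫⁻ o in A, P.rnDeriv Q o ∂Q - ∫⁻ _ in A, ENNReal.ofReal α ∂Q :=
        lintegral_sub measurable_const hfin ((ae_restrict_iff' hAm).2 (.of_forall fun _ ho => ho))
    _ ≤ P A - ENNReal.ofReal α * Q A := by
        rw [setLIntegral_const]
        exact tsub_le_tsub_right (Measure.setLIntegral_rnDeriv_le A) _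
    _ ≤ K := tsub_le_iff_right.2 (h A hAm)

theorem le_hockeyStick_add {E : Type*} [MeasurableSpace E] (α : ℝ) {P Q : Measure E}
    [IsFiniteMeasure P] [IsFiniteMeasure Q] (hPQ : P ≪ Q) (A : Set E) :
    P A ≤ hockeyStick α P Q + ENNReal.ofReal α * Q A := by
  calc P A = ∫⁻ o in A, P.rnDeriv Q o ∂Q := (Measure.setLIntegral_rnDeriv hPQ A).symm
    _ ≤ ∫⁻ o in A, (P.rnDeriv Q o - ENNReal.ofReal α + ENNReal.ofReal α) ∂Q :=
        lintegral_mono fun _ => le_tsub_add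
    _ = ∫⁻ o in A, (P.rnDeriv Q o - ENNReal.ofReal α) ∂Q + ENNReal.ofReal α * Q A := by
        rw [lintegral_add_right _ measurable_const, setLIntegral_const]
    _ ≤ hockeyStick α P Q + ENNReal.ofReal α * Q A := by
        gcongr
        exact setLIntegral_le_lintegral _ _

theorem MoG_apply {K : ℕ} (μ p : Fin K → ℝ) (σ : ℝ) (S : Set ℝ) :
    MoG μ p σ S = ∑ k, ENNReal.ofReal (p k) * gaussianReal (μ k) (σ ^ 2).toNNReal S := by
  have hv : (⟨σ ^ 2, sq_nonneg σ⟩ : ℝ≥0) = (σ ^ 2).toNNReal :=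
    (Real.toNNReal_of_nonneg (sq_nonneg σ)).symm
  simp only [MoG, Measure.finsetSum_apply, Measure.smul_apply, smul_eq_mul]
  rw [← hv]

instance isFiniteMeasure_MoG {K : ℕ} (μ p : Fin K → ℝ) (σ : ℝ) : IsFiniteMeasure (MoG μ p σ) := by
  refine ⟨?_⟩
  rw [MoG_apply]
  exact ENNReal.sum_lt_top.2 fun k _ =>
    ENNReal.mul_lt_top ENNReal.ofReal_lt_top (measure_lt_top _ _)

theorem MoG_absolutelyContinuous {K : ℕ} (μ μ' p : Fin K → ℝ) {σ : ℝ} (hσ : 0 < σ) :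
    MoG μ p σ ≪ MoG μ' p σ := by
  have hv : (σ ^ 2).toNNReal ≠ 0 := (Real.toNNReal_pos.2 (pow_pos hσ 2)).ne'
  intro S hS
  rw [MoG_apply, Finset.sum_eq_zero_iff] at hS ⊢
  intro k hk
  rcases mul_eq_zero.1 (hS k hk) with h | h
  · rw [h, zero_mul]
  · rw [(gaussianReal_absolutelyContinuous _ hv) ((gaussianReal_absolutelyContinuous' _ hv) h),
      mul_zero]

/-- Transfers the one-dimensional divergence to averages of `m`. The index `κ ω` counts affected
windows, and `hw` says that its law under the weights `w` is `p`. The same `b`, hence the same `S`,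
must serve every outcome in `I` and both datasets. -/
theorem IsGaussianTest.sum_le {D K : ℕ} {C σ : ℝ} (hσ : 0 < σ)
    {m : EuclideanSpace ℝ (Fin D) → ℝ≥0∞} (hm : IsGaussianTest C σ m)
    (α : ℝ) (b : EuclideanSpace ℝ (Fin D)) {Ω : Type*} (I : Finset Ω) (w : Ω → ℝ≥0∞)
    (κ : Ω → ℕ) (p : Fin K → ℝ)
    (hw : ∀ φ : ℕ → ℝ≥0∞, ∑ ω ∈ I, w ω * φ (κ ω) = ∑ k : Fin K, ENNReal.ofReal (p k) * φ k)
    (μ : ℕ → ℝ) (u u' : Ω → EuclideanSpace ℝ (Fin D))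
    (hu : ∀ ω ∈ I, ‖u ω - b‖ ≤ C * μ (κ ω)) (hu' : ∀ ω ∈ I, ‖u' ω - b‖ ≤ C * μ (κ ω)) :
    ∑ ω ∈ I, w ω * m (u ω) ≤
      hockeyStick α (MoG (fun i => -1 * μ i) p σ) (MoG (fun i => 1 * μ i) p σ) +
        ENNReal.ofReal α * ∑ ω ∈ I, w ω * m (u' ω) := by
  obtain ⟨S, -, h⟩ := hm b
  calc ∑ ω ∈ I, w ω * m (u ω)
      ≤ ∑ ω ∈ I, w ω * gaussianReal (-1 * μ (κ ω)) (σ ^ 2).toNNReal S := by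
        refine Finset.sum_le_sum fun ω hω => ?_
        rw [neg_one_mul]
        gcongr
        exact (h _ _ (hu ω hω)).1
    _ = MoG (fun i => -1 * μ i) p σ S := by
        rw [MoG_apply, hw fun i => gaussianReal (-1 * μ i) (σ ^ 2).toNNReal S]
    _ ≤ _ := le_hockeyStick_add α
        (MoG_absolutelyContinuous _ (fun i => 1 * μ i) _ hσ) S
    _ ≤ _ := by
        gcongr
        rw [MoG_apply, ← hw fun i => gaussianReal (1 * μ i) (σ ^ 2).toNNReal S]
        refine Finset.sum_le_sum fun ω hω => ?_
        rw [one_mul]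
        gcongr
        exact (h _ _ (hu' ω hω)).2

/-! ### Expectations with respect to batch distributions -/

/-- The expectation of `h` with respect to `q`. -/
noncomputable def expectation {B : Type*} (q : PMF B) (h : B → ℝ≥0∞) : ℝ≥0∞ := ∑' b, q b * h b

theorem expectation_bind {A B : Type*} (p : PMF A) (f : A → PMF B) (h : B → ℝ≥0∞) :
    expectation (p.bind f) h = expectation p fun a => expectation (f a) h := by
  simp only [expectation, PMF.bind_apply, ← ENNReal.tsum_mul_left, ← ENNReal.tsum_mul_right]
  rw [ENNReal.tsum_comm]
  simp only [mul_assoc]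

theorem expectation_pure {A : Type*} (a : A) (h : A → ℝ≥0∞) :
    expectation (PMF.pure a) h = h a := by
  rw [expectation, tsum_eq_single a fun b hb => by simp [hb]]
  simp

theorem expectation_map {A B : Type*} (p : PMF A) (f : A → B) (h : B → ℝ≥0∞) :
    expectation (p.map f) h = expectation p fun a => h (f a) := by
  rw [PMF.map, expectation_bind]
  simp [expectation_pure]

theorem expectation_comm {A B : Type*} (p : PMF A) (q : PMF B) (h : A → B → ℝ≥0∞) :
    (expectation p fun a => expectation q (h a)) =
      expectation q fun b => expectation p fun a => h a b := by
  simp only [expectation, ← ENNReal.tsum_mul_left]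
  rw [ENNReal.tsum_comm]
  simp only [mul_left_comm]

theorem expectation_mono {A : Type*} (p : PMF A) {h h' : A → ℝ≥0∞} (hh : ∀ a, h a ≤ h' a) :
    expectation p h ≤ expectation p h' :=
  ENNReal.tsum_le_tsum fun a => by gcongr; exact hh a

theorem expectation_const {A : Type*} (p : PMF A) (c : ℝ≥0∞) : (expectation p fun _ => c) = c := by
  rw [expectation, ENNReal.tsum_mul_right, p.tsum_coe, one_mul]

theorem expectation_add_mul {A : Type*} (p : PMF A) (c d : ℝ≥0∞) (h : A → ℝ≥0∞) :
    (expectation p fun a => c + d * h a) = c + d * expectation p h := by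
  rw [← expectation_const p c]
  simp only [expectation, mul_add, ENNReal.tsum_add, ← ENNReal.tsum_mul_left, mul_left_comm,
    ENNReal.tsum_mul_right, p.tsum_coe, one_mul]

theorem expectation_uniformOfFintype {A : Type*} [Fintype A] [Nonempty A] (h : A → ℝ≥0∞) :
    expectation (PMF.uniformOfFintype A) h = ∑ a, (Fintype.card A : ℝ≥0∞)⁻¹ * h a := by
  simp [expectation, tsum_fintype]

theorem mixture_apply {B E : Type*} [MeasurableSpace E] (p : PMF B) (κ : B → Measure E)
    {A : Set E} (hA : MeasurableSet A) : mixture p κ A = expectation p fun b => κ b A := by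
  simp [mixture, Measure.sum_apply _ hA, expectation]

/-- Gaussian tests of the sum of the values `g` over the batch accept `q` at most with probability
`K + a * (acceptance probability of q')`. -/
def TestDominated {A : Type*} {D : ℕ} (C σ : ℝ) (g : A → EuclideanSpace ℝ (Fin D)) (K a : ℝ≥0∞)
    (q q' : PMF (Multiset A)) : Prop :=
  ∀ m, IsGaussianTest C σ m → (expectation q fun y => m (y.map g).sum) ≤
    K + a * expectation q' fun y => m (y.map g).sum

theorem expectation_aggregate_cons {A : Type*} (p : PMF (Multiset A)) (ps : List (PMF (Multiset A)))
    (h : Multiset A → ℝ≥0∞) : expectation (aggregate (p :: ps)) h =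
      expectation p fun s => expectation (aggregate ps) fun y => h (s + y) := by
  rw [aggregate, expectation_bind]
  simp only [expectation_map]

/-- All draws except the one at `k` have the same law on both sides. Freezing them translates the
test, which stays Gaussian because `IsGaussianTest` holds at every base point. -/
theorem testDominated_aggregate {A ι : Type*} {D : ℕ} {C σ : ℝ}
    {g : A → EuclideanSpace ℝ (Fin D)} {K a : ℝ≥0∞} {F F' : ι → PMF (Multiset A)} {k : ι}
    (hne : ∀ i, i ≠ k → F i = F' i) (hk : TestDominated C σ g K a (F k) (F' k)) :
    ∀ l : List ι, l.Nodup → k ∈ l →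
      TestDominated C σ g K a (aggregate (l.map F)) (aggregate (l.map F'))
  | [], _, h => by simp at h
  | i :: l, hnd, hmem => by
    obtain ⟨hil, hl⟩ := List.nodup_cons.1 hnd
    intro m hm
    simp only [List.map_cons, expectation_aggregate_cons, Multiset.map_add, Multiset.sum_add]
    by_cases hi : i = k
    · subst hi
      -- By `Nodup`, `k` does not recur in the tail.
      have hrest : l.map F = l.map F' :=
        List.map_congr_left fun j hj => hne j fun h => hil (h ▸ hj)
      rw [hrest, expectation_comm, expectation_comm (F' i), ← expectation_add_mul]
      refine expectation_mono _ fun y => ?_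
      simpa only [add_comm] using hk _ (hm.comp_const_add (y.map g).sum)
    · rw [hne i hi, ← expectation_add_mul]
      refine expectation_mono _ fun s => ?_
      exact testDominated_aggregate hne hk l hl
        ((List.mem_cons.1 hmem).resolve_left fun h => hi h.symm) _ (hm.comp_const_add _)

/-! ### Top-level sampling -/

/-- Right multiplication by a transposition exchanges the positions `i` and `j`, so all fibres of `π
↦ π⁻¹ n` have the same size. -/
theorem card_perm_apply_eq {N : ℕ} (n i : Fin N) :
    N * (Finset.univ.filter fun π : Equiv.Perm (Fin N) => π i = n).card =
      Fintype.card (Equiv.Perm (Fin N)) := by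
  have hconst (j : Fin N) : (Finset.univ.filter fun π : Equiv.Perm (Fin N) => π j = n).card =
      (Finset.univ.filter fun π : Equiv.Perm (Fin N) => π i = n).card :=
    Finset.card_nbij' (fun π => π * Equiv.swap i j) (fun π => π * Equiv.swap i j)
      (by intro π; simp) (by intro π; simp) (by intro π; simp [mul_assoc])
      (by intro π; simp [mul_assoc])
  have h := Finset.card_eq_sum_card_fiberwise (s := (Finset.univ : Finset (Equiv.Perm (Fin N))))
    (t := Finset.univ) (f := fun π => π⁻¹ n) fun _ _ => Finset.mem_coe.2 (Finset.mem_univ _)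
  rw [Finset.card_univ] at h
  rw [h, Finset.sum_congr rfl fun j _ => ?_, Finset.sum_const, Finset.card_univ, Fintype.card_fin,
    smul_eq_mul]
  rw [← hconst j]
  congr 1
  ext π
  simp only [Finset.mem_filter, Finset.mem_univ, true_and, Equiv.Perm.inv_eq_iff_eq]
  exact eq_comm

theorem card_perm_selected {N N' : ℕ} (h : N' ≤ N) (n : Fin N) :
    N * (Finset.univ.filter fun π : Equiv.Perm (Fin N) =>
      ∃ k : Fin N', π (Fin.castLE h k) = n).card =
      N' * Fintype.card (Equiv.Perm (Fin N)) := by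
  classical
  have hU : (Finset.univ.filter fun π : Equiv.Perm (Fin N) =>
      ∃ k : Fin N', π (Fin.castLE h k) = n) =
      Finset.univ.biUnion fun k : Fin N' =>
        Finset.univ.filter fun π : Equiv.Perm (Fin N) => π (Fin.castLE h k) = n := by
    ext π
    simp
  rw [hU, Finset.card_biUnion, Finset.mul_sum]
  · simp only [card_perm_apply_eq, Finset.sum_const, Finset.card_univ, Fintype.card_fin,
      smul_eq_mul]
  · intro k _ k' _ hkk'
    refine Finset.disjoint_filter.2 fun π _ hk hk' => hkk' ?_
    exact Fin.castLE_injective h (π.injective (hk.trans hk'.symm))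

/-- The test form of `H_α(P‖P) ≤ max 0 (1 - α)`, used when the modified series is not selected. -/
theorem le_ofReal_max_add_mul {α : ℝ} (hα : 0 ≤ α) {e : ℝ≥0∞} (he : e ≤ 1) :
    e ≤ ENNReal.ofReal (max 0 (1 - α)) + ENNReal.ofReal α * e := by
  have h1 : (1 : ℝ≥0∞) ≤ ENNReal.ofReal (max 0 (1 - α)) + ENNReal.ofReal α := by
    rw [← ENNReal.ofReal_add (le_max_left _ _) hα, ← ENNReal.ofReal_one]
    exact ENNReal.ofReal_le_ofReal (by linarith [le_max_right 0 (1 - α)])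
  calc e = 1 * e := (one_mul e).symm
    _ ≤ (ENNReal.ofReal (max 0 (1 - α)) + ENNReal.ofReal α) * e := by gcongr
    _ ≤ _ := by
      rw [add_mul]
      gcongr
      exact mul_le_of_le_one_right' he

theorem expectation_sampleBatch_le {N N' L D : ℕ} {A : Type*} {C σ : ℝ} (h : N' ≤ N)
    {bottom : Series L → PMF (Multiset A)} {g : A → EuclideanSpace ℝ (Fin D)} {K : ℝ≥0∞} {α ρ : ℝ}
    (hα : 0 ≤ α) (hρ : ρ = (N' : ℝ) / N) {x x' : Dataset N L} {n : Fin N}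
    (hne : ∀ i, i ≠ n → x i = x' i)
    (hn : TestDominated C σ g K (ENNReal.ofReal α) (bottom (x n)) (bottom (x' n)))
    {m : EuclideanSpace ℝ (Fin D) → ℝ≥0∞} (hm : IsGaussianTest C σ m) (hm1 : ∀ u, m u ≤ 1) :
    (expectation (sampleBatch h bottom x) fun y => m (y.map g).sum) ≤
      ENNReal.ofReal ((1 - ρ) * max 0 (1 - α)) + ENNReal.ofReal ρ * K +
        ENNReal.ofReal α * expectation (sampleBatch h bottom x') fun y => m (y.map g).sum := by
  classical
  set c := Fintype.card (Equiv.Perm (Fin N)) with hc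
  set sel := Finset.univ.filter fun π : Equiv.Perm (Fin N) => ∃ k : Fin N', π (Fin.castLE h k) = n
    with hsel
  set e := fun (x : Dataset N L) (π : Equiv.Perm (Fin N)) =>
    expectation (aggregate ((List.finRange N').map fun k => bottom (x (π (Fin.castLE h k)))))
      fun y => m (y.map g).sum with he
  have hexp (x : Dataset N L) : (expectation (sampleBatch h bottom x) fun y => m (y.map g).sum) =
      ∑ π, (c : ℝ≥0∞)⁻¹ * e x π := by
    rw [sampleBatch, expectation_bind, expectation_uniformOfFintype]
  have hin : ∀ π ∈ sel, e x π ≤ K + ENNReal.ofReal α * e x' π := by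
    intro π hπ
    obtain ⟨k, hk⟩ := (Finset.mem_filter.1 hπ).2
    refine testDominated_aggregate (F := fun k => bottom (x (π (Fin.castLE h k))))
      (F' := fun k => bottom (x' (π (Fin.castLE h k)))) (k := k) (fun i hi => ?_) ?_ _
      (List.nodup_finRange N') (List.mem_finRange k) m hm
    · have : π (Fin.castLE h i) ≠ n := fun hi' =>
        hi (Fin.castLE_injective h (π.injective (hi'.trans hk.symm)))
      rw [hne _ this]
    · simpa only [hk] using hn
  have hout : ∀ π ∈ selᶜ, e x π ≤
      ENNReal.ofReal (max 0 (1 - α)) + ENNReal.ofReal α * e x' π := by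
    intro π hπ
    have hπ' : ∀ k : Fin N', π (Fin.castLE h k) ≠ n := by
      simpa [hsel] using hπ
    have hee : e x π = e x' π := by
      simp only [he, hne _ (hπ' _)]
    rw [hee]
    refine le_ofReal_max_add_mul hα ?_
    calc e x' π ≤ expectation _ fun _ => 1 := expectation_mono _ fun y => hm1 _
      _ = 1 := expectation_const _ _
  have hc0 : (0 : ℝ) < c := Nat.cast_pos.2 Fintype.card_pos
  have hcinv : (c : ℝ≥0∞)⁻¹ = ENNReal.ofReal (c : ℝ)⁻¹ := by
    rw [ENNReal.ofReal_inv_of_pos hc0, ENNReal.ofReal_natCast]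
  have hN : (0 : ℝ) < N := Nat.cast_pos.2 n.pos
  have hselR : (sel.card : ℝ) = ρ * c := by
    have := congrArg (Nat.cast : ℕ → ℝ) (card_perm_selected h n)
    push_cast at this
    rw [hρ]
    field_simp
    linarith
  have hcompl : (selᶜ.card : ℝ) = (1 - ρ) * c := by
    have := congrArg (Nat.cast : ℕ → ℝ) (Finset.card_add_card_compl sel)
    push_cast at this
    rw [← hc] at this
    linarith
  have hK : ENNReal.ofReal ρ = (c : ℝ≥0∞)⁻¹ * sel.card := by
    rw [hcinv, ← ENNReal.ofReal_natCast, ← ENNReal.ofReal_mul (inv_nonneg.2 hc0.le), hselR]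
    congr 1
    field_simp
  have hK' : ENNReal.ofReal ((1 - ρ) * max 0 (1 - α)) =
      (c : ℝ≥0∞)⁻¹ * selᶜ.card * ENNReal.ofReal (max 0 (1 - α)) := by
    rw [hcinv, ← ENNReal.ofReal_natCast, ← ENNReal.ofReal_mul (inv_nonneg.2 hc0.le), hcompl,
      ← ENNReal.ofReal_mul' (le_max_left _ _)]
    congr 1
    field_simp
  rw [hexp, hexp, ← Finset.mul_sum, ← Finset.mul_sum, ← Finset.sum_add_sum_compl sel,
    ← Finset.sum_add_sum_compl sel (e x')]
  calc (c : ℝ≥0∞)⁻¹ * (∑ π ∈ sel, e x π + ∑ π ∈ selᶜ, e x π)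
      ≤ (c : ℝ≥0∞)⁻¹ * (∑ π ∈ sel, (K + ENNReal.ofReal α * e x' π) +
          ∑ π ∈ selᶜ, (ENNReal.ofReal (max 0 (1 - α)) + ENNReal.ofReal α * e x' π)) := by
        gcongr with π hπ π hπ
        · exact hin π hπ
        · exact hout π hπ
    _ = _ := by
        rw [hK, hK', Finset.sum_add_distrib, Finset.sum_add_distrib, ← Finset.mul_sum,
          ← Finset.mul_sum, Finset.sum_const, Finset.sum_const, nsmul_eq_mul, nsmul_eq_mul]
        ring

/-! ### Starting points that see the modified time index -/

theorem exists_crop_eq_off {L LC LF : ℕ} (hL : LC + LF ≤ L - LF + 1) {x x' : Series L} {t₀ : Fin L}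
    (hx : ∀ i, i ≠ t₀ → x i = x' i) :
    ∃ W : Finset (Fin (L - LF + 1)), W.card = LC + LF ∧
      ∀ t ∉ W, crop LC LF x t = crop LC LF x' t := by
  set W₀ := Finset.univ.filter fun t : Fin (L - LF + 1) =>
    (t : ℕ) ≤ LC + t₀ ∧ LC + t₀ < t + (LC + LF) with hW₀
  have hcard : W₀.card ≤ LC + LF := by
    have hsub : W₀.map Fin.valEmbedding ⊆
        Finset.Icc (LC + t₀ + 1 - (LC + LF)) (LC + t₀) := by
      intro i hi
      obtain ⟨t, ht, rfl⟩ := Finset.mem_map.1 hi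
      have h := (Finset.mem_filter.1 ht).2
      simp only [Fin.valEmbedding_apply, Finset.mem_Icc]
      omega
    have h := Finset.card_le_card hsub
    rw [Finset.card_map, Nat.card_Icc] at h
    omega
  -- Near the ends of the series fewer windows see the entry. Enlarging the set to exactly `LC + LF`
  -- elements, possible by `hL`, yields the stated binomial parameters without a monotonicity
  -- argument.
  obtain ⟨W, hW, hWc⟩ := Finset.exists_superset_card_eq hcard (by simpa using hL)
  refine ⟨W, hWc, fun t ht => funext fun j => ?_⟩
  have ht' : t ∉ W₀ := fun h => ht (hW h)
  unfold crop prependZeros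
  split_ifs with h
  · refine hx _ fun he => ht' ?_
    have he' : (t : ℕ) + j - LC = t₀ := congrArg Fin.val he
    refine Finset.mem_filter.2 ⟨Finset.mem_univ _, ?_⟩
    have := j.2
    omega
  · rfl

theorem norm_clip_le {D : ℕ} {C : ℝ} (hC : 0 < C) (v : EuclideanSpace ℝ (Fin D)) :
    ‖clip C v‖ ≤ C := by
  have hpos : (0 : ℝ) < max 1 (‖v‖ / C) := lt_of_lt_of_le one_pos (le_max_left _ _)
  rw [clip, norm_smul, norm_inv, Real.norm_of_nonneg hpos.le, inv_mul_le_iff₀ hpos]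
  exact (div_le_iff₀ hC).1 (le_max_right _ _)

theorem norm_sum_sub_sum_le {D : ℕ} {ι : Type*} [Fintype ι] [DecidableEq ι] {C : ℝ}
    {v b : ι → EuclideanSpace ℝ (Fin D)} (J : Finset ι) (hv : ∀ j, ‖v j‖ ≤ C) (hb : ∀ j, ‖b j‖ ≤ C)
    (hvb : ∀ j ∉ J, v j = b j) : ‖∑ j, v j - ∑ j, b j‖ ≤ C * (2 * (J.card : ℝ)) := by
  rw [← Finset.sum_sub_distrib, ← Finset.sum_subset (Finset.subset_univ J)
    fun j _ hj => by rw [hvb j hj, sub_self]]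
  calc ‖∑ j ∈ J, (v j - b j)‖ ≤ ∑ j ∈ J, (C + C) :=
        norm_sum_le_of_le _ fun j _ => (norm_sub_le _ _).trans (add_le_add (hv j) (hb j))
    _ = C * (2 * (J.card : ℝ)) := by rw [Finset.sum_const, nsmul_eq_mul]; ring

/-! ### Sampling with replacement -/

section withReplacement

variable {τ : Type*} [Fintype τ] [DecidableEq τ] {lam : ℕ}

/-- Tuples are grouped by the set `J` of coordinates that hit `W`; each fibre is a product of copies
of `W` and `Wᶜ`. -/
theorem sum_apply_card_mem (W : Finset τ) (φ : ℕ → ℝ≥0∞) :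
    ∑ t : Fin lam → τ, φ (Finset.univ.filter fun j => t j ∈ W).card =
      ∑ k : Fin (lam + 1),
        ((lam.choose k * W.card ^ (k : ℕ) * Wᶜ.card ^ (lam - k) : ℕ) : ℝ≥0∞) * φ k := by
  have hfiber (J : Finset (Fin lam)) :
      (Finset.univ.filter fun t : Fin lam → τ => (Finset.univ.filter fun j => t j ∈ W) = J).card =
        W.card ^ J.card * Wᶜ.card ^ (lam - J.card) := by
    have h : (Finset.univ.filter fun t : Fin lam → τ =>
        (Finset.univ.filter fun j => t j ∈ W) = J) =
        Fintype.piFinset fun j => if j ∈ J then W else Wᶜ := by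
      ext t
      simp only [Finset.mem_filter, Finset.mem_univ, true_and, Fintype.mem_piFinset,
        Finset.ext_iff (s₂ := J)]
      refine forall_congr' fun j => ?_
      split_ifs with hj <;> simp [hj]
    rw [h, Fintype.card_piFinset]
    simp only [apply_ite Finset.card]
    rw [Finset.prod_ite]
    simp [Finset.filter_not, Finset.card_sdiff]
  rw [← Finset.sum_fiberwise_of_maps_to (s := Finset.univ)
    (t := (Finset.univ : Finset (Fin lam)).powerset)
    (g := fun t : Fin lam → τ => Finset.univ.filter fun j => t j ∈ W) (by simp)]
  have hJ (J : Finset (Fin lam)) :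
      ∑ t : Fin lam → τ with (Finset.univ.filter fun j => t j ∈ W) = J,
        φ (Finset.univ.filter fun j => t j ∈ W).card =
      ((W.card ^ J.card * Wᶜ.card ^ (lam - J.card) : ℕ) : ℝ≥0∞) * φ J.card := by
    rw [Finset.sum_congr rfl fun t ht => by rw [(Finset.mem_filter.1 ht).2], Finset.sum_const,
      hfiber, nsmul_eq_mul]
  simp only [hJ]
  rw [Finset.sum_powerset_apply_card fun k =>
    ((W.card ^ k * Wᶜ.card ^ (lam - k) : ℕ) : ℝ≥0∞) * φ k]
  rw [Finset.card_univ, Fintype.card_fin, ← Fin.sum_univ_eq_sum_range fun k =>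
    lam.choose k • (((W.card ^ k * Wᶜ.card ^ (lam - k) : ℕ) : ℝ≥0∞) * φ k)]
  refine Finset.sum_congr rfl fun k _ => ?_
  rw [nsmul_eq_mul]
  push_cast
  ring

theorem sum_apply_card_mem_eq_binomial [Nonempty τ] (W : Finset τ) (φ : ℕ → ℝ≥0∞) :
    ∑ t : Fin lam → τ, (Fintype.card (Fin lam → τ) : ℝ≥0∞)⁻¹ *
        φ (Finset.univ.filter fun j => t j ∈ W).card =
      ∑ k : Fin (lam + 1), ENNReal.ofReal
        (binomialWeight lam ((W.card : ℝ) / (Fintype.card τ : ℝ)) k) * φ k := by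
  have hT : (0 : ℝ) < Fintype.card τ := Nat.cast_pos.2 Fintype.card_pos
  rw [← Finset.mul_sum, sum_apply_card_mem, Finset.mul_sum]
  refine Finset.sum_congr rfl fun k _ => ?_
  rw [← mul_assoc]
  congr 1
  have hkl : (k : ℕ) ≤ lam := Nat.lt_succ_iff.1 k.2
  have hcompl : (Wᶜ.card : ℝ) = Fintype.card τ - W.card := by
    have := congrArg (Nat.cast : ℕ → ℝ) (Finset.card_add_card_compl W)
    push_cast at this
    linarith
  rw [Fintype.card_fun, Fintype.card_fin, ← ENNReal.ofReal_natCast, ← ENNReal.ofReal_natCast,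
    ← ENNReal.ofReal_inv_of_pos (by push_cast; positivity), ← ENNReal.ofReal_mul (by positivity)]
  congr 1
  rw [binomialWeight, one_sub_div hT.ne', ← hcompl, div_pow, div_pow]
  push_cast
  have hpow : (Fintype.card τ : ℝ) ^ lam =
      (Fintype.card τ : ℝ) ^ (k : ℕ) * (Fintype.card τ : ℝ) ^ (lam - k) := by
    rw [← pow_add, Nat.add_sub_cancel' hkl]
  rw [hpow]
  field_simp

/-- Replacing, coordinate by coordinate, the values outside `W` by independent uniform elements of
the complement of `W` does not change a sum over all tuples. -/
theorem sum_resample (W : Finset τ) (F : (Fin lam → τ) → ℝ≥0∞) :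
    ∑ b : Fin lam → {c // c ∉ W}, ∑ t : Fin lam → τ,
        F (fun j => if t j ∈ W then t j else b j) =
      Fintype.card (Fin lam → {c // c ∉ W}) * ∑ t : Fin lam → τ, F t := by
  -- Exchanges `t j` and `b j` wherever `t j ∉ W`. The new `t j` is again outside `W`, so the map is
  -- an involution.
  set swap : ((Fin lam → {c // c ∉ W}) × (Fin lam → τ)) →
      ((Fin lam → {c // c ∉ W}) × (Fin lam → τ)) :=
    fun p => (fun j => if h : p.2 j ∈ W then p.1 j else ⟨p.2 j, h⟩,
      fun j => if p.2 j ∈ W then p.2 j else p.1 j) with hswap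
  have hinv : Function.Involutive swap := by
    rintro ⟨b, t⟩
    refine Prod.ext (funext fun j => ?_) (funext fun j => ?_)
    · by_cases h : t j ∈ W <;> simp [hswap, h, (b j).2]
    · by_cases h : t j ∈ W <;> simp [hswap, h, (b j).2]
  calc ∑ b : Fin lam → {c // c ∉ W}, ∑ t : Fin lam → τ,
        F (fun j => if t j ∈ W then t j else b j)
      = ∑ p : (Fin lam → {c // c ∉ W}) × (Fin lam → τ), F (swap p).2 :=
        (Fintype.sum_prod_type' fun (b : Fin lam → {c // c ∉ W}) (t : Fin lam → τ) =>
          F fun j => if t j ∈ W then t j else b j).symm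
    _ = ∑ p : (Fin lam → {c // c ∉ W}) × (Fin lam → τ), F p.2 :=
        Equiv.sum_comp (Function.Involutive.toPerm swap hinv) fun p => F p.2
    _ = _ := by
        rw [Fintype.sum_prod_type]
        simp

/-- Draws outside `W` are resampled as a tuple `b` fixed in advance. For fixed `b` the base `∑ j, v
(b j)` is the same for `v` and `v'` and does not depend on which coordinates hit `W`; each hit moves
the sum by at most `2 * C`. -/
theorem IsGaussianTest.sum_withReplacement_le [Nonempty τ] {D : ℕ} {C σ : ℝ} (hσ : 0 < σ)
    {m : EuclideanSpace ℝ (Fin D) → ℝ≥0∞} (hm : IsGaussianTest C σ m) (α : ℝ) (W : Finset τ)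
    {v v' : τ → EuclideanSpace ℝ (Fin D)} (hv : ∀ t, ‖v t‖ ≤ C) (hv' : ∀ t, ‖v' t‖ ≤ C)
    (hvv' : ∀ t ∉ W, v t = v' t) :
    ∑ t : Fin lam → τ, (Fintype.card (Fin lam → τ) : ℝ≥0∞)⁻¹ * m (∑ j, v (t j)) ≤
      hockeyStick α
        (MoG (K := lam + 1) (fun i => -1 * (2 * (i : ℝ)))
          (fun i => binomialWeight lam ((W.card : ℝ) / (Fintype.card τ : ℝ)) i) σ)
        (MoG (K := lam + 1) (fun i => 1 * (2 * (i : ℝ)))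
          (fun i => binomialWeight lam ((W.card : ℝ) / (Fintype.card τ : ℝ)) i) σ) +
      ENNReal.ofReal α *
        ∑ t : Fin lam → τ, (Fintype.card (Fin lam → τ) : ℝ≥0∞)⁻¹ * m (∑ j, v' (t j)) := by
  set H := hockeyStick α
    (MoG (K := lam + 1) (fun i => -1 * (2 * (i : ℝ)))
      (fun i => binomialWeight lam ((W.card : ℝ) / (Fintype.card τ : ℝ)) i) σ)
    (MoG (K := lam + 1) (fun i => 1 * (2 * (i : ℝ)))
      (fun i => binomialWeight lam ((W.card : ℝ) / (Fintype.card τ : ℝ)) i) σ)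
  set c := (Fintype.card (Fin lam → τ) : ℝ≥0∞)⁻¹
  have key (b : Fin lam → EuclideanSpace ℝ (Fin D)) (hb : ∀ j, ‖b j‖ ≤ C) (r : Fin lam → τ → τ)
      (hr : ∀ j t, t ∉ W → v (r j t) = b j) (hr' : ∀ j t, t ∉ W → v' (r j t) = b j) :
      ∑ t : Fin lam → τ, c * m (∑ j, v (r j (t j))) ≤
        H + ENNReal.ofReal α * ∑ t : Fin lam → τ, c * m (∑ j, v' (r j (t j))) :=
    hm.sum_le hσ α (∑ j, b j) Finset.univ (fun _ => c)
      (fun t : Fin lam → τ => (Finset.univ.filter fun j => t j ∈ W).card) _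
      (sum_apply_card_mem_eq_binomial W) (fun k => 2 * (k : ℝ)) _ _
      (fun t _ => norm_sum_sub_sum_le _ (fun j => hv _) hb fun j hj => hr j _ (by simpa using hj))
      (fun t _ => norm_sum_sub_sum_le _ (fun j => hv' _) hb fun j hj => hr' j _ (by simpa using hj))
  rcases isEmpty_or_nonempty {c // c ∉ W} with hW | hW
  -- If `W` is everything there are no substitutes, and the base `0` works.
  · have hC : 0 ≤ C := (norm_nonneg _).trans (hv (Classical.arbitrary τ))
    exact key (fun _ => 0) (fun _ => by simpa using hC) (fun _ t => t)
      (fun _ t ht => (hW.false ⟨t, ht⟩).elim) (fun _ t ht => (hW.false ⟨t, ht⟩).elim)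
  · set n := (Fintype.card (Fin lam → {c // c ∉ W}) : ℝ≥0∞) with hn
    have hn0 : n ≠ 0 := Nat.cast_ne_zero.2 Fintype.card_ne_zero
    have hntop : n ≠ ∞ := ENNReal.natCast_ne_top _
    -- Multiplying by the number `n` of tuples `b` turns both sides into sums over `b`, to be
    -- compared term by term.
    rw [← ENNReal.mul_le_mul_iff_right hn0 hntop, mul_add, mul_left_comm,
      ← sum_resample W fun t => c * m (∑ j, v (t j)),
      ← sum_resample W fun t => c * m (∑ j, v' (t j)), Finset.mul_sum]
    calc _ ≤ ∑ b : Fin lam → {c // c ∉ W}, (H + ENNReal.ofReal α * ∑ t : Fin lam → τ,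
          c * m (∑ j, v' (if t j ∈ W then t j else b j))) := by
          refine Finset.sum_le_sum fun b _ => ?_
          refine key (fun j => v (b j)) (fun j => hv _) (fun j t => if t ∈ W then t else b j)
            (fun j t ht => by rw [if_neg ht]) (fun j t ht => ?_)
          rw [if_neg ht, hvv' _ (b j).2]
      _ = _ := by
          rw [Finset.sum_add_distrib, Finset.sum_const, Finset.card_univ, nsmul_eq_mul]

end withReplacement

/-! ### Poisson sampling -/

theorem sum_powerset_eq_binomial {τ : Type*} (W : Finset τ) {r : ℝ≥0} (hr : r ≤ 1) (φ : ℕ → ℝ≥0∞) :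
    ∑ s ∈ W.powerset, (r : ℝ≥0∞) ^ s.card * (1 - (r : ℝ≥0∞)) ^ (W.card - s.card) * φ s.card =
      ∑ k : Fin (W.card + 1), ENNReal.ofReal (binomialWeight W.card r k) * φ k := by
  have hr1 : (1 - (r : ℝ≥0∞)) = ENNReal.ofReal (1 - r) := by
    rw [ENNReal.ofReal_sub _ r.coe_nonneg, ENNReal.ofReal_one, ENNReal.ofReal_coe_nnreal]
  rw [Finset.sum_powerset_apply_card fun k =>
    (r : ℝ≥0∞) ^ k * (1 - (r : ℝ≥0∞)) ^ (W.card - k) * φ k,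
    ← Fin.sum_univ_eq_sum_range fun k =>
      W.card.choose k • ((r : ℝ≥0∞) ^ k * (1 - (r : ℝ≥0∞)) ^ (W.card - k) * φ k)]
  refine Finset.sum_congr rfl fun k _ => ?_
  have h1r : (0 : ℝ) ≤ 1 - r := sub_nonneg.2 (by exact_mod_cast hr)
  rw [nsmul_eq_mul, binomialWeight, ENNReal.ofReal_mul (by positivity),
    ENNReal.ofReal_mul (by positivity), ENNReal.ofReal_natCast, ENNReal.ofReal_pow r.coe_nonneg,
    ENNReal.ofReal_pow h1r, ← hr1, ENNReal.ofReal_coe_nnreal]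
  ring

section poisson

variable {τ : Type*} [Fintype τ] [DecidableEq τ]

theorem sum_finset_eq_sum_powerset (W : Finset τ) (F : Finset τ → ℝ≥0∞) :
    ∑ s, F s = ∑ s₀ ∈ Wᶜ.powerset, ∑ s₁ ∈ W.powerset, F (s₀ ∪ s₁) := by
  rw [← Finset.sum_product']
  symm
  refine Finset.sum_nbij' (fun p => p.1 ∪ p.2) (fun s => (s \ W, s ∩ W)) (by simp) ?_ ?_ ?_
    (by simp)
  · intro s _
    simp only [Finset.mem_product, Finset.mem_powerset]
    exact ⟨fun t ht => by simpa using (Finset.mem_sdiff.1 ht).2, Finset.inter_subset_right⟩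
  · rintro ⟨s₀, s₁⟩ h
    obtain ⟨h₀, h₁⟩ := Finset.mem_product.1 h
    rw [Finset.mem_powerset] at h₀ h₁
    refine Prod.ext ?_ ?_ <;> ext t <;> have h₀' := @h₀ t <;> have h₁' := @h₁ t <;>
      simp only [Finset.mem_compl] at h₀' <;>
      simp only [Finset.mem_sdiff, Finset.mem_inter, Finset.mem_union] <;> tauto
  · intro s _
    exact Finset.sdiff_union_inter s W

/-- Conditioning on the chosen part `s₀` outside `W` gives a base common to `v` and `v'`. The part
inside `W` is independent of `s₀` and has binomial size. -/
theorem IsGaussianTest.sum_poisson_le {D : ℕ} {C σ : ℝ} (hσ : 0 < σ)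
    {m : EuclideanSpace ℝ (Fin D) → ℝ≥0∞} (hm : IsGaussianTest C σ m) (α : ℝ) (W : Finset τ)
    {r : ℝ≥0} (hr : r ≤ 1)
    {v v' : τ → EuclideanSpace ℝ (Fin D)} (hv : ∀ t, ‖v t‖ ≤ C) (hv' : ∀ t, ‖v' t‖ ≤ C)
    (hvv' : ∀ t ∉ W, v t = v' t) :
    ∑ s : Finset τ, (r : ℝ≥0∞) ^ s.card * (1 - (r : ℝ≥0∞)) ^ (Fintype.card τ - s.card) *
        m (∑ t ∈ s, v t) ≤
      hockeyStick α
        (MoG (K := W.card + 1) (fun i => -1 * (i : ℝ)) (fun i => binomialWeight W.card r i) σ)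
        (MoG (K := W.card + 1) (fun i => 1 * (i : ℝ)) (fun i => binomialWeight W.card r i) σ) +
      ENNReal.ofReal α *
        ∑ s : Finset τ, (r : ℝ≥0∞) ^ s.card * (1 - (r : ℝ≥0∞)) ^ (Fintype.card τ - s.card) *
          m (∑ t ∈ s, v' t) := by
  set H := hockeyStick α
    (MoG (K := W.card + 1) (fun i => -1 * (i : ℝ)) (fun i => binomialWeight W.card r i) σ)
    (MoG (K := W.card + 1) (fun i => 1 * (i : ℝ)) (fun i => binomialWeight W.card r i) σ)
  set w₀ := fun s : Finset τ => (r : ℝ≥0∞) ^ s.card * (1 - (r : ℝ≥0∞)) ^ (Wᶜ.card - s.card)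
  set w₁ := fun s : Finset τ => (r : ℝ≥0∞) ^ s.card * (1 - (r : ℝ≥0∞)) ^ (W.card - s.card)
  have hdisj {s₀ s₁ : Finset τ} (h₀ : s₀ ∈ Wᶜ.powerset) (h₁ : s₁ ∈ W.powerset) :
      Disjoint s₀ s₁ :=
    Finset.disjoint_of_subset_left (Finset.mem_powerset.1 h₀)
      (Finset.disjoint_of_subset_right (Finset.mem_powerset.1 h₁) disjoint_compl_left)
  have hsplit (v : τ → EuclideanSpace ℝ (Fin D)) :
      ∑ s : Finset τ, (r : ℝ≥0∞) ^ s.card * (1 - (r : ℝ≥0∞)) ^ (Fintype.card τ - s.card) *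
        m (∑ t ∈ s, v t) =
      ∑ s₀ ∈ Wᶜ.powerset, w₀ s₀ *
        ∑ s₁ ∈ W.powerset, w₁ s₁ * m (∑ t ∈ s₀, v t + ∑ t ∈ s₁, v t) := by
    rw [sum_finset_eq_sum_powerset W]
    refine Finset.sum_congr rfl fun s₀ h₀ => ?_
    rw [Finset.mul_sum]
    refine Finset.sum_congr rfl fun s₁ h₁ => ?_
    have hc₀ := Finset.card_le_card (Finset.mem_powerset.1 h₀)
    have hc₁ := Finset.card_le_card (Finset.mem_powerset.1 h₁)
    have hc := Finset.card_add_card_compl W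
    rw [Finset.sum_union (hdisj h₀ h₁), Finset.card_union_of_disjoint (hdisj h₀ h₁),
      show Fintype.card τ - (s₀.card + s₁.card) = (Wᶜ.card - s₀.card) + (W.card - s₁.card) by omega,
      pow_add, pow_add]
    ring
  have hnorm {v : τ → EuclideanSpace ℝ (Fin D)} (hv : ∀ t, ‖v t‖ ≤ C)
      (b : EuclideanSpace ℝ (Fin D)) (s : Finset τ) :
      ‖b + ∑ t ∈ s, v t - b‖ ≤ C * (s.card : ℝ) := by
    rw [add_sub_cancel_left]
    calc ‖∑ t ∈ s, v t‖ ≤ ∑ t ∈ s, C := norm_sum_le_of_le _ fun t _ => hv t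
      _ = C * (s.card : ℝ) := by rw [Finset.sum_const, nsmul_eq_mul, mul_comm]
  have htotal : ∑ s₀ ∈ Wᶜ.powerset, w₀ s₀ = 1 := by
    rw [Finset.sum_pow_mul_eq_add_pow, add_tsub_cancel_of_le (by exact_mod_cast hr), one_pow]
  -- `H` is distributed over the total mass of the `s₀`, so that one inequality per `s₀` suffices.
  rw [hsplit, hsplit, ← one_mul H, ← htotal, Finset.sum_mul, Finset.mul_sum,
    ← Finset.sum_add_distrib]
  refine Finset.sum_le_sum fun s₀ h₀ => ?_
  rw [mul_left_comm, ← mul_add]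
  gcongr
  have hbase : ∑ t ∈ s₀, v' t = ∑ t ∈ s₀, v t :=
    Finset.sum_congr rfl fun t ht =>
      (hvv' t (Finset.mem_compl.1 (Finset.mem_powerset.1 h₀ ht))).symm
  rw [hbase]
  exact hm.sum_le hσ α (∑ t ∈ s₀, v t) W.powerset w₁ Finset.card _
    (sum_powerset_eq_binomial W hr) (fun k => (k : ℝ)) _ _
    (fun s _ => hnorm hv _ s) (fun s _ => hnorm hv' _ s)

end poisson

/-! ### The bottom-level mechanisms are dominated -/

section bottom

variable {L LC LF D lam : ℕ} {C σ : ℝ} {g : (Fin (LC + LF) → ℝ) → EuclideanSpace ℝ (Fin D)}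
  {x x' : Series L} {t₀ : Fin L}

theorem testDominated_sampleWithReplacement (hσ : 0 < σ) (hL : LC + LF ≤ L - LF + 1)
    (hg : ∀ a, ‖g a‖ ≤ C) (hx : ∀ i, i ≠ t₀ → x i = x' i) (α : ℝ) :
    TestDominated C σ g
      (hockeyStick α (pairWithReplacement (-1) L LC LF lam σ)
        (pairWithReplacement 1 L LC LF lam σ)) (ENNReal.ofReal α)
      (sampleWithReplacement LC LF lam x) (sampleWithReplacement LC LF lam x') := by
  obtain ⟨W, hW, hWx⟩ := exists_crop_eq_off hL hx
  intro m hm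
  have h := hm.sum_withReplacement_le (lam := lam) hσ α W (v := fun t => g (crop LC LF x t))
    (v' := fun t => g (crop LC LF x' t)) (fun _ => hg _) (fun _ => hg _)
    fun t ht => by rw [hWx t ht]
  rw [hW, Fintype.card_fin] at h
  simpa only [sampleWithReplacement, expectation_map, expectation_uniformOfFintype,
    Multiset.map_map, Function.comp_def, pairWithReplacement, Finset.sum] using h

theorem expectation_poissonSubset {T : ℕ} {r : ℝ≥0} (hr : r ≤ 1) (h : Finset (Fin T) → ℝ≥0∞) :
    expectation (poissonSubset T r hr) h =
      ∑ s, (r : ℝ≥0∞) ^ s.card * (1 - (r : ℝ≥0∞)) ^ (T - s.card) * h s := by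
  rw [expectation, tsum_fintype]
  rfl

theorem testDominated_samplePoisson (hσ : 0 < σ) (hL : LC + LF ≤ L - LF + 1)
    (hg : ∀ a, ‖g a‖ ≤ C) (hx : ∀ i, i ≠ t₀ → x i = x' i) (α : ℝ) :
    TestDominated C σ g
      (hockeyStick α (pairPoisson (-1) L LC LF lam σ) (pairPoisson 1 L LC LF lam σ))
      (ENNReal.ofReal α) (samplePoisson LC LF lam x) (samplePoisson LC LF lam x') := by
  obtain ⟨W, hW, hWx⟩ := exists_crop_eq_off hL hx
  intro m hm
  have h := hm.sum_poisson_le hσ α W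
    (min_le_left 1 ((lam : ℝ≥0) / ((L - LF + 1 : ℕ) : ℝ≥0)))
    (v := fun t => g (crop LC LF x t)) (v' := fun t => g (crop LC LF x' t))
    (fun _ => hg _) (fun _ => hg _) fun t ht => by rw [hWx t ht]
  rw [hW, Fintype.card_fin] at h
  have hr : ((min 1 ((lam : ℝ≥0) / ((L - LF + 1 : ℕ) : ℝ≥0)) : ℝ≥0) : ℝ) =
      min 1 ((lam : ℝ) / ((L - LF + 1 : ℕ) : ℝ)) := by
    rw [NNReal.coe_min, NNReal.coe_div, NNReal.coe_one, NNReal.coe_natCast, NNReal.coe_natCast]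
  rw [hr] at h
  simpa only [samplePoisson, expectation_map, expectation_poissonSubset,
    Multiset.map_map, Function.comp_def, pairPoisson, Finset.sum] using h

end bottom

/-! ### The training step -/

theorem privacyProfile_trainingStep_le {N L LC LF D lam Lam : ℕ} {O : Type*} (hN : Lam / lam ≤ N)
    (bottom : Series L → PMF (Multiset (Fin (LC + LF) → ℝ)))
    (f : EuclideanSpace ℝ (Fin D) → (Fin LC → ℝ) → O) (loss : O → (Fin LF → ℝ) → ℝ)
    (θ : EuclideanSpace ℝ (Fin D)) (η : ℝ) {σ C : ℝ} (hσ : 0 < σ) (hC : 0 < C)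
    {ρ : ℝ} (hρ : ρ = ((Lam / lam : ℕ) : ℝ) / (N : ℝ)) {α : ℝ} (hα : 0 ≤ α) {K : ℝ≥0∞}
    (hbottom : ∀ (x x' : Series L) (t₀ : Fin L), (∀ i, i ≠ t₀ → x i = x' i) →
      TestDominated C σ (fun a => clip C (subsequenceGradient f loss θ a)) K (ENNReal.ofReal α)
        (bottom x) (bottom x')) :
    privacyProfile (trainingStep (N := N) hN bottom f loss θ η σ C) α ≤
      ENNReal.ofReal ((1 - ρ) * max 0 (1 - α)) + ENNReal.ofReal ρ * K := by
  have hmeas (u : EuclideanSpace ℝ (Fin D)) : Measurable fun z : EuclideanSpace ℝ (Fin D) =>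
      θ - η • ((1 / (Lam : ℝ)) • (u + (σ * C) • z)) := by fun_prop
  have hfinite (x : Dataset N L) :
      IsFiniteMeasure (trainingStep (N := N) hN bottom f loss θ η σ C x) := by
    refine ⟨?_⟩
    rw [trainingStep, mixture_apply _ _ MeasurableSet.univ]
    refine lt_of_le_of_lt ?_ ENNReal.one_lt_top
    calc _ ≤ expectation (sampleBatch hN bottom x) fun _ => 1 := by
          refine expectation_mono _ fun y => ?_
          rw [noisyTrainingStep, Measure.map_apply (hmeas _) MeasurableSet.univ]
          exact prob_le_one
      _ = 1 := expectation_const _ _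
  refine iSup_le fun x => iSup_le fun x' => iSup_le fun hxx' => ?_
  obtain ⟨n, hne, t₀, ht₀⟩ := hxx'
  refine hockeyStick_le fun A hA => ?_
  -- Post-processing: the affine parameter update is absorbed into the event, leaving a test of the
  -- noisy gradient sum.
  set B := (fun w : EuclideanSpace ℝ (Fin D) => θ - η • ((1 / (Lam : ℝ)) • w)) ⁻¹' A with hBdef
  have hB : MeasurableSet B :=
    (show Measurable fun w : EuclideanSpace ℝ (Fin D) => θ - η • ((1 / (Lam : ℝ)) • w) by
      fun_prop) hA
  have hstep (y : Multiset (Fin (LC + LF) → ℝ)) : noisyTrainingStep f loss θ η σ C Lam y A =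
      stdGaussian (EuclideanSpace ℝ (Fin D))
        {z | (y.map fun a => clip C (subsequenceGradient f loss θ a)).sum + (σ * C) • z ∈ B} := by
    rw [noisyTrainingStep, Measure.map_apply (hmeas _) hA]
    rfl
  simp only [trainingStep, mixture_apply _ _ hA, hstep]
  refine expectation_sampleBatch_le hN hα hρ hne (hbottom _ _ t₀ fun i hi => ht₀ i fun h => hi ?_)
    (isGaussianTest_stdGaussian hC hσ hB) fun _ => prob_le_one
  -- A range of length `1` starting at `t₀` contains only `t₀`.
  exact Fin.ext (by omega)

end BilevelForecasting

theorem mainTheorem9 {N L LC LF D lam Lam : ℕ} {O : Type*}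
    (hlam : 1 ≤ lam) (hLam : 1 ≤ Lam) (hN : Lam / lam ≤ N)
    (hLF : LF ≤ L) (hL : LC + LF ≤ L - LF + 1)
    (f : EuclideanSpace ℝ (Fin D) → (Fin LC → ℝ) → O) (loss : O → (Fin LF → ℝ) → ℝ)
    (θ : EuclideanSpace ℝ (Fin D)) {η σ C : ℝ} (hη : η ≠ 0) (hσ : 0 < σ) (hC : 0 < C)
    {ρ : ℝ} (hρ : ρ = ((Lam / lam : ℕ) : ℝ) / (N : ℝ)) :
    (∀ α : ℝ, 0 ≤ α →
      BilevelForecasting.privacyProfile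
          (BilevelForecasting.trainingStep (N := N) (L := L) hN
            (BilevelForecasting.sampleWithReplacement LC LF lam) f loss θ η σ C) α
        ≤ ENNReal.ofReal ((1 - ρ) * max 0 (1 - α)) +
          ENNReal.ofReal ρ * BilevelForecasting.hockeyStick α
            (BilevelForecasting.pairWithReplacement (-1) L LC LF lam σ)
            (BilevelForecasting.pairWithReplacement 1 L LC LF lam σ)) ∧
    (∀ α : ℝ, 0 ≤ α →
      BilevelForecasting.privacyProfile
          (BilevelForecasting.trainingStep (N := N) (L := L) hN
            (BilevelForecasting.samplePoisson LC LF lam) f loss θ η σ C) α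
        ≤ ENNReal.ofReal ((1 - ρ) * max 0 (1 - α)) +
          ENNReal.ofReal ρ * BilevelForecasting.hockeyStick α
            (BilevelForecasting.pairPoisson (-1) L LC LF lam σ)
            (BilevelForecasting.pairPoisson 1 L LC LF lam σ)) :=
  ⟨fun α hα => BilevelForecasting.privacyProfile_trainingStep_le hN _ f loss θ η hσ hC hρ hα
      fun _ _ _ hx => BilevelForecasting.testDominated_sampleWithReplacement hσ hL
        (fun _ => BilevelForecasting.norm_clip_le hC _) hx α,
    fun α hα => BilevelForecasting.privacyProfile_trainingStep_le hN _ f loss θ η hσ hC hρ hα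
      fun _ _ _ hx => BilevelForecasting.testDominated_samplePoisson hσ hL
        (fun _ => BilevelForecasting.norm_clip_le hC _) hx α⟩
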